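/- Let $(M_p,g_p)$ and $(M_q,g_q)$ be finite-dimensional smooth Riemannian manifolds (without boundary) of constant sectional curvature $c_p$ and $c_q$ respectively, let $M=M_p\times M_q$ carry the product metric $g$, and let $\varphi$ be a golden structure on $M$ with which $g$ is compatible, i.e. a smooth $(1,1)$ tensor field with $\varphi^2=\varphi+I$ and $g(\varphi X,Y)=g(X,\varphi Y)$ for all $X,Y$; that is, $M=M_p(c_p)\times M_q(c_q)$ is a locally Golden product space form. Assume that $\varphi$ is integrable, i.e. $\nabla\varphi=0$ for the Levi-Civita connection $\nabla$ of $g$. Let $R(X,Y)=\nabla_X\nabla_Y-\nabla_Y\nabla_X-\nabla_{[X,Y]}$ be the curvature tensor of $g$, let $S(X,Y)=\sum_i g(R(E_i,X)Y,E_i)$ be its Ricci tensor, where $(E_i)$ is a $g$-orthonormal basis of the tangent space, and put $$(R(X,Y)\cdot S)(Z,W)=-S(R(X,Y)Z,W)-S(Z,R(X,Y)W).$$ Then $$(R(\varphi X,Y)\cdot S)(\varphi Z,W)=0$$ for every point of $M$ and all tangent vectors $X,Y,Z,W$ of $M$ at that point. -/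

import Mathlib

open Bundle
open scoped Manifold ContDiff

set_option maxSynthPendingDepth 3

namespace GoldenGeometry

section Chart

variable {E : Type*} [NormedAddCommGroup E] [NormedSpace ℝ E]

/-- The first-kind Christoffel form of a metric `G` given on a vector space: for `D = dG` at a point,
`(X, Y, Z) ↦ 1/2 (D_X G(Y, Z) + D_Y G(X, Z) - D_Z G(X, Y))`. -/
noncomputable def koszulForm (D : E →L[ℝ] E →L[ℝ] E →L[ℝ] ℝ) : E →L[ℝ] E →L[ℝ] E →L[ℝ] ℝ :=
  let C : (E →L[ℝ] E →L[ℝ] ℝ) →L[ℝ] (E →L[ℝ] E →L[ℝ] ℝ) :=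
    (ContinuousLinearMap.flipₗᵢ ℝ E E ℝ).toContinuousLinearEquiv
  let T : E →L[ℝ] E →L[ℝ] E →L[ℝ] ℝ := C ∘L D.flip
  (1 / 2 : ℝ) • (D + D.flip - T)

theorem koszulForm_apply (D : E →L[ℝ] E →L[ℝ] E →L[ℝ] ℝ) (X Y Z : E) :
    koszulForm D X Y Z = 1 / 2 * (D X Y Z + D Y X Z - D Z X Y) := by
  simp [koszulForm]

/-- The Christoffel symbols `Γ_u(X, Y)` of a metric `G` on (an open subset of) `E`, that is, the
solution of `G_u(Γ_u(X, Y), Z) = 1/2 (D_X G(Y, Z) + D_Y G(X, Z) - D_Z G(X, Y))` for all `Z`. -/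
noncomputable def christoffel (G : E → E →L[ℝ] E →L[ℝ] ℝ) (u : E) : E →L[ℝ] E →L[ℝ] E :=
  (ContinuousLinearMap.compL ℝ E (E →L[ℝ] ℝ) E (G u).inverse) ∘L koszulForm (fderiv ℝ G u)

/-- The defining equation of the Christoffel symbols holds wherever `G` is positive definite. -/
theorem christoffel_spec [FiniteDimensional ℝ E] (G : E → E →L[ℝ] E →L[ℝ] ℝ) (u : E)
    (pos : ∀ v, v ≠ 0 → 0 < G u v v) (X Y Z : E) :
    G u (christoffel G u X Y) Z =
      1 / 2 * (fderiv ℝ G u X Y Z + fderiv ℝ G u Y X Z - fderiv ℝ G u Z X Y) := by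
  have inj : Function.Injective (G u : E →ₗ[ℝ] E →L[ℝ] ℝ) := by
    rw [← LinearMap.ker_eq_bot, LinearMap.ker_eq_bot']
    intro v hv
    by_contra h
    have hp := pos v h
    have h0 : G u v = 0 := hv
    simp [h0] at hp
  have hdim : Module.finrank ℝ E = Module.finrank ℝ (E →L[ℝ] ℝ) := by
    rw [← LinearEquiv.finrank_eq
      (LinearMap.toContinuousLinearMap (𝕜 := ℝ) (E := E) (F' := ℝ))]
    exact (Subspace.dual_finrank_eq (K := ℝ) (V := E)).symm
  let e : E ≃L[ℝ] (E →L[ℝ] ℝ) :=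
    (LinearEquiv.ofInjectiveOfFinrankEq (G u : E →ₗ[ℝ] E →L[ℝ] ℝ) inj hdim).toContinuousLinearEquiv
  have he : (e : E →L[ℝ] (E →L[ℝ] ℝ)) = G u := by
    ext v w
    rfl
  have key : ∀ f : E →L[ℝ] ℝ, G u ((G u).inverse f) = f := by
    intro f
    rw [← he, ContinuousLinearMap.inverse_equiv]
    exact e.apply_symm_apply f
  simp only [christoffel, ContinuousLinearMap.comp_apply, ContinuousLinearMap.compL_apply]
  rw [key, koszulForm_apply]

/-- The curvature endomorphism `R(X, Y) = ∇_X ∇_Y - ∇_Y ∇_X - ∇_[X, Y]` of a metric `G` on (an open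
subset of) `E` at the point `u`, for `∇_X Y = D_X Y + Γ(X, Y)`. -/
noncomputable def curvatureInChart (G : E → E →L[ℝ] E →L[ℝ] ℝ) (u X Y : E) : E →L[ℝ] E :=
  fderiv ℝ (christoffel G) u X Y - fderiv ℝ (christoffel G) u Y X
    + christoffel G u X ∘L christoffel G u Y - christoffel G u Y ∘L christoffel G u X

theorem curvatureInChart_add (G : E → E →L[ℝ] E →L[ℝ] ℝ) (u V W X Y : E) :
    curvatureInChart G u (V + W) X Y =
      curvatureInChart G u V X Y + curvatureInChart G u W X Y := by
  simp only [curvatureInChart, map_add, add_apply, sub_apply, ContinuousLinearMap.comp_apply]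
  abel

theorem curvatureInChart_smul (G : E → E →L[ℝ] E →L[ℝ] ℝ) (u : E) (c : ℝ) (V X Y : E) :
    curvatureInChart G u (c • V) X Y = c • curvatureInChart G u V X Y := by
  simp only [curvatureInChart, map_smul, add_apply, sub_apply, ContinuousLinearMap.comp_apply,
    smul_apply, smul_sub, smul_add]

end Chart

section Manifold

variable {E : Type*} [NormedAddCommGroup E] [NormedSpace ℝ E]
  {H : Type*} [TopologicalSpace H] {I : ModelWithCorners ℝ E H}
  {M : Type*} [TopologicalSpace M] [ChartedSpace H M] [IsManifold I ∞ M]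

/-- A smooth Riemannian metric on the manifold `M`. -/
abbrev SmoothMetric (I : ModelWithCorners ℝ E H) (M : Type*) [TopologicalSpace M]
    [ChartedSpace H M] [IsManifold I ∞ M] :=
  ContMDiffRiemannianMetric I ∞ E (fun x : M => TangentSpace I x)

/-- The differential at `u` of the inverse of the preferred chart at `x`. (Every fibre
`TangentSpace I p` is by definition the model space `E`.) -/
noncomputable def chartSymmDeriv (I : ModelWithCorners ℝ E H) {M : Type*} [TopologicalSpace M]
    [ChartedSpace H M] (x : M) (u : E) :
    E →L[ℝ] E :=
  mfderiv 𝓘(ℝ, E) I (extChartAt I x).symm u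

/-- The metric `g` read in the preferred chart at `x` (pulled back by the inverse chart). -/
noncomputable def metricInChart (g : SmoothMetric I M) (x : M) (u : E) : E →L[ℝ] E →L[ℝ] ℝ :=
  let B : E →L[ℝ] E →L[ℝ] ℝ := g.inner ((extChartAt I x).symm u)
  B.bilinearComp (chartSymmDeriv I x u) (chartSymmDeriv I x u)

/-- The curvature `R(X, Y)` of the Levi-Civita connection of `g` at `x`, computed in the preferred
chart at `x`. The fibre `TangentSpace I x` is `E`, identified with the tangent space through the
differential of that same chart, so no further change of coordinates is needed. -/
noncomputable def curvature (g : SmoothMetric I M) (x : M) (X Y : TangentSpace I x) :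
    TangentSpace I x →L[ℝ] TangentSpace I x :=
  curvatureInChart (E := E) (metricInChart g x) (extChartAt I x x) X Y

/-- The linear map `V ↦ R(V, X) Y` at `x`. -/
noncomputable def curvatureFirstSlot (g : SmoothMetric I M) (x : M) (X Y : TangentSpace I x) :
    TangentSpace I x →ₗ[ℝ] TangentSpace I x where
  toFun V := curvature g x V X Y
  map_add' V W := curvatureInChart_add (E := E) _ _ V W X Y
  map_smul' c V := curvatureInChart_smul (E := E) _ _ c V X Y

/-- The Ricci tensor `S(X, Y) = trace (V ↦ R(V, X) Y)`. -/
noncomputable def ricci (g : SmoothMetric I M) (x : M) (X Y : TangentSpace I x) : ℝ :=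
  LinearMap.trace ℝ (TangentSpace I x) (curvatureFirstSlot g x X Y)

/-- In a `g`-orthonormal basis, `S(X, Y) = ∑ i, g(R(Eᵢ, X) Y, Eᵢ)`. -/
theorem ricci_eq_sum (g : SmoothMetric I M) (x : M) {ι : Type*} [Fintype ι] [DecidableEq ι]
    (b : Module.Basis ι ℝ (TangentSpace I x))
    (hb : ∀ i j, g.inner x (b i) (b j) = if i = j then 1 else 0) (X Y : TangentSpace I x) :
    ricci g x X Y = ∑ i, g.inner x (curvature g x (b i) X Y) (b i) := by
  have hrepr : ∀ (v : TangentSpace I x) (i : ι), b.repr v i = g.inner x v (b i) := by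
    intro v i
    have h : g.inner x (∑ j, b.repr v j • b j) (b i) = b.repr v i := by
      rw [map_sum, sum_apply]
      simp [hb]
    rw [← h, b.sum_repr]
  rw [ricci, LinearMap.trace_eq_matrix_trace ℝ b, Matrix.trace]
  refine Finset.sum_congr rfl fun i _ => ?_
  rw [Matrix.diag_apply, LinearMap.toMatrix_apply, hrepr]
  rfl

/-- The derivation `R(X, Y)` applied to the Ricci tensor:
`(R(X, Y) · S)(Z, W) = - S(R(X, Y) Z, W) - S(Z, R(X, Y) W)`. -/
noncomputable def curvatureDotRicci (g : SmoothMetric I M) (x : M)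
    (X Y Z W : TangentSpace I x) : ℝ :=
  - ricci g x (curvature g x X Y Z) W - ricci g x Z (curvature g x X Y W)

/-- The sectional curvature of the plane spanned by `X` and `Y`. -/
noncomputable def sectionalCurvature (g : SmoothMetric I M) (x : M) (X Y : TangentSpace I x) : ℝ :=
  g.inner x (curvature g x X Y Y) X /
    (g.inner x X X * g.inner x Y Y - g.inner x X Y ^ 2)

/-- `(M, g)` has constant sectional curvature `c`. -/
def HasConstantSectionalCurvature (g : SmoothMetric I M) (c : ℝ) : Prop :=
  ∀ (x : M) (X Y : TangentSpace I x), LinearIndependent ℝ ![X, Y] →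
    sectionalCurvature g x X Y = c

/-- A field of endomorphisms of the tangent spaces. -/
abbrev EndField (I : ModelWithCorners ℝ E H) (M : Type*) [TopologicalSpace M]
    [ChartedSpace H M] :=
  ∀ x : M, TangentSpace I x →L[ℝ] TangentSpace I x

/-- `(M, g, φ)` is a Golden Riemannian manifold: `φ` is a smooth `(1,1)` tensor field with
`φ² = φ + I`, and `g` is `φ`-compatible. -/
structure IsGoldenRiemannian (g : SmoothMetric I M) (φ : EndField I M) : Prop where
  smooth : ContMDiff I (I.prod 𝓘(ℝ, E →L[ℝ] E)) ∞
    (fun x => TotalSpace.mk' (E →L[ℝ] E)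
      (E := fun x : M => TangentSpace I x →L[ℝ] TangentSpace I x) x (φ x))
  golden : ∀ (x : M) (X : TangentSpace I x), φ x (φ x X) = φ x X + X
  compatible : ∀ (x : M) (X Y : TangentSpace I x), g.inner x (φ x X) Y = g.inner x X (φ x Y)

/-- The field `φ` read in the preferred chart at `x`. -/
noncomputable def endInChart (φ : EndField I M) (x : M) (u : E) : E →L[ℝ] E :=
  let A : E →L[ℝ] E := φ ((extChartAt I x).symm u)
  (chartSymmDeriv I x u).inverse ∘L A ∘L chartSymmDeriv I x u

/-- The covariant derivative `(∇_X φ) Y = ∇_X (φ Y) - φ (∇_X Y)` at `x` for the Levi-Civita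
connection of `g`, computed in the preferred chart at `x`. -/
noncomputable def covDerivEnd (g : SmoothMetric I M) (φ : EndField I M) (x : M)
    (X Y : TangentSpace I x) : TangentSpace I x :=
  let u : E := extChartAt I x x
  let Γ : E →L[ℝ] E →L[ℝ] E := christoffel (metricInChart g x) u
  let Φ : E → E →L[ℝ] E := endInChart φ x
  fderiv ℝ Φ u X Y + Γ X (Φ u Y) - Φ u (Γ X Y)

/-- Integrability of a golden structure on a Riemannian manifold: `∇ φ = 0` for the Levi-Civita
connection `∇` of `g`. -/
def IsIntegrable (g : SmoothMetric I M) (φ : EndField I M) : Prop :=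
  ∀ (x : M) (X Y : TangentSpace I x), covDerivEnd g φ x X Y = 0

end Manifold

section Product

variable {E₁ : Type*} [NormedAddCommGroup E₁] [NormedSpace ℝ E₁]
  {H₁ : Type*} [TopologicalSpace H₁] {I₁ : ModelWithCorners ℝ E₁ H₁}
  {M₁ : Type*} [TopologicalSpace M₁] [ChartedSpace H₁ M₁] [IsManifold I₁ ∞ M₁]
  {E₂ : Type*} [NormedAddCommGroup E₂] [NormedSpace ℝ E₂]
  {H₂ : Type*} [TopologicalSpace H₂] {I₂ : ModelWithCorners ℝ E₂ H₂}
  {M₂ : Type*} [TopologicalSpace M₂] [ChartedSpace H₂ M₂] [IsManifold I₂ ∞ M₂]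

/-- `g` is the product metric `π₁^* g₁ + π₂^* g₂` on `M₁ × M₂`. -/
def IsProductMetric (g₁ : SmoothMetric I₁ M₁) (g₂ : SmoothMetric I₂ M₂)
    (g : SmoothMetric (I₁.prod I₂) (M₁ × M₂)) : Prop :=
  ∀ (z : M₁ × M₂) (X Y : TangentSpace (I₁.prod I₂) z),
    g.inner z X Y =
      g₁.inner z.1 (mfderiv (I₁.prod I₂) I₁ Prod.fst z X)
          (mfderiv (I₁.prod I₂) I₁ Prod.fst z Y) +
        g₂.inner z.2 (mfderiv (I₁.prod I₂) I₂ Prod.snd z X)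
          (mfderiv (I₁.prod I₂) I₂ Prod.snd z Y)

/-- `(M₁(c₁) × M₂(c₂), g, φ)` is a locally Golden product space form: the factors have constant
sectional curvatures `c₁` and `c₂`, `g` is the product metric, and `φ` is a golden structure with
which `g` is compatible. No relation between `φ` and the splitting is imposed; the canonical structure
`ψ I` on `TM₁`, `(1 - ψ) I` on `TM₂` (`ψ` the golden ratio) is the main special case. -/
structure IsGoldenProductSpaceForm (g₁ : SmoothMetric I₁ M₁) (c₁ : ℝ)
    (g₂ : SmoothMetric I₂ M₂) (c₂ : ℝ) (g : SmoothMetric (I₁.prod I₂) (M₁ × M₂))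
    (φ : EndField (I₁.prod I₂) (M₁ × M₂)) : Prop where
  spaceForm₁ : HasConstantSectionalCurvature g₁ c₁
  spaceForm₂ : HasConstantSectionalCurvature g₂ c₂
  product : IsProductMetric g₁ g₂ g
  golden : IsGoldenRiemannian g φ

end Product

end GoldenGeometry

/-!
The product of two space forms is Ricci-semisymmetric: the derivation `R(X, Y)` annihilates the
Ricci tensor `S` for *all* tangent vectors, so in particular for the arguments `φ X, Y, φ Z, W`.

On a space form of curvature `c` and dimension `n`, the curvature tensor minus
`c (g(Y, Z) X - g(X, Z) Y)` has the symmetries of a curvature tensor and vanishes on every plane, so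
it is zero (`eq_zero_of_curvature_symmetries`). Tracing gives `S = c (n - 1) g`, and
`R(X, Y) · g = 0` because `R(X, Y)` is skew-adjoint; hence `R · S = 0` on each factor. In dimension at
most one there are no planes and the same formula holds trivially, for any `c`. On the product, the
metric read in the product chart is the sum of the metrics of the factors, so the Christoffel
symbols, the curvature and, taking traces, the Ricci tensor split; then `R · S` is the sum of the
corresponding expressions on the factors.

The symmetries of the curvature are proved in a chart, from the two defining properties of the
Levi-Civita connection: it is torsion-free (which gives the first Bianchi identity) and compatible
with the metric (which gives skew-adjointness, by the symmetry of second derivatives). This uses that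
the coordinate expression of a smooth metric is smooth and positive definite near the centre of the
chart (`isMetricNear_metricInChart`).
-/

namespace GoldenGeometry

open Filter Topology

/-! ### The Levi-Civita connection and the curvature in a chart -/

section Chart

variable {E : Type*} [NormedAddCommGroup E] [NormedSpace ℝ E]

/-- `G` is, near the point `u` of the vector space `E`, a Riemannian metric of class `C²`. -/
structure IsMetricNear (G : E → E →L[ℝ] E →L[ℝ] ℝ) (u : E) : Prop where
  contDiffAt : ContDiffAt ℝ 2 G u
  symm : ∀ᶠ v in 𝓝 u, ∀ X Y, G v X Y = G v Y X
  pos : ∀ᶠ v in 𝓝 u, ∀ X, X ≠ 0 → 0 < G v X X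

/-- Differentiation commutes with the evaluation of a bilinear form at fixed vectors. -/
theorem fderiv_apply_apply {F F' : Type*} [NormedAddCommGroup F] [NormedSpace ℝ F]
    [NormedAddCommGroup F'] [NormedSpace ℝ F'] {E' : Type*} [NormedAddCommGroup E']
    [NormedSpace ℝ E'] {B : E → E' →L[ℝ] F →L[ℝ] F'} {u : E} (hB : DifferentiableAt ℝ B u)
    (X : E) (Y : E') (Z : F) : fderiv ℝ B u X Y Z = fderiv ℝ (fun v => B v Y Z) u X := by
  have h := ((hB.hasFDerivAt.clm_apply (hasFDerivAt_const Y u)).clm_apply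
    (hasFDerivAt_const Z u)).fderiv
  rw [h]
  simp

namespace IsMetricNear

variable {G : E → E →L[ℝ] E →L[ℝ] ℝ} {u : E}

theorem eventually (h : IsMetricNear G u) : ∀ᶠ v in 𝓝 u, IsMetricNear G v := by
  filter_upwards [h.contDiffAt.eventually (by simp), h.symm.eventually_nhds,
    h.pos.eventually_nhds] with v h₁ h₂ h₃ using ⟨h₁, h₂, h₃⟩

theorem differentiableAt (h : IsMetricNear G u) : DifferentiableAt ℝ G u :=
  h.contDiffAt.differentiableAt (by simp)

theorem eq_of_forall_apply_eq (h : IsMetricNear G u) {X Y : E}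
    (hXY : ∀ Z, G u X Z = G u Y Z) : X = Y := by
  by_contra hne
  have := h.pos.self_of_nhds (X - Y) (sub_ne_zero.2 hne)
  simp [hXY] at this

theorem fderiv_symm (h : IsMetricNear G u) (X Y Z : E) :
    fderiv ℝ G u X Y Z = fderiv ℝ G u X Z Y := by
  rw [fderiv_apply_apply h.differentiableAt, fderiv_apply_apply h.differentiableAt]
  have : (fun v => G v Y Z) =ᶠ[𝓝 u] fun v => G v Z Y := h.symm.mono fun v hv => hv Y Z
  rw [this.fderiv_eq]

variable [FiniteDimensional ℝ E]

theorem inner_christoffel (h : IsMetricNear G u) (X Y Z : E) :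
    G u (christoffel G u X Y) Z =
      1 / 2 * (fderiv ℝ G u X Y Z + fderiv ℝ G u Y X Z - fderiv ℝ G u Z X Y) :=
  christoffel_spec G u h.pos.self_of_nhds X Y Z

/-- The Levi-Civita connection is torsion-free. -/
theorem christoffel_symm (h : IsMetricNear G u) (X Y : E) :
    christoffel G u X Y = christoffel G u Y X := by
  refine h.eq_of_forall_apply_eq fun Z => ?_
  rw [h.inner_christoffel, h.inner_christoffel, h.fderiv_symm Z X Y]
  ring

/-- The Levi-Civita connection is compatible with the metric. -/
theorem fderiv_eq (h : IsMetricNear G u) (X Y Z : E) :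
    fderiv ℝ G u X Y Z = G u (christoffel G u X Y) Z + G u Y (christoffel G u X Z) := by
  rw [h.symm.self_of_nhds Y, h.inner_christoffel, h.inner_christoffel, h.fderiv_symm Y X Z,
    h.fderiv_symm Z X Y, h.fderiv_symm X Z Y]
  ring

/-- One derivative is lost: the Christoffel symbols are built from the inverse of the metric, which
is as smooth as the metric by nondegeneracy, and from its first derivatives. -/
theorem contDiffAt_christoffel (h : IsMetricNear G u) :
    ContDiffAt ℝ 1 (christoffel G) u := by
  have hdim : Module.finrank ℝ E = Module.finrank ℝ (E →L[ℝ] ℝ) := by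
    rw [← LinearEquiv.finrank_eq
      (LinearMap.toContinuousLinearMap (𝕜 := ℝ) (E := E) (F' := ℝ))]
    exact (Subspace.dual_finrank_eq (K := ℝ) (V := E)).symm
  have inj : Function.Injective (G u : E →ₗ[ℝ] E →L[ℝ] ℝ) := fun X Y hXY =>
    h.eq_of_forall_apply_eq fun Z => DFunLike.congr_fun (show G u X = G u Y from hXY) Z
  let e : E ≃L[ℝ] (E →L[ℝ] ℝ) :=
    (LinearEquiv.ofInjectiveOfFinrankEq (G u : E →ₗ[ℝ] E →L[ℝ] ℝ) inj hdim).toContinuousLinearEquiv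
  have he : (e : E →L[ℝ] (E →L[ℝ] ℝ)) = G u := by
    ext v w
    rfl
  have hinv : ContDiffAt ℝ 1 (fun v => (G v).inverse) u := by
    have := contDiffAt_map_inverse (𝕜 := ℝ) (n := 1) e
    rw [he] at this
    exact this.comp u (h.contDiffAt.of_le (by norm_num))
  have hD : ContDiffAt ℝ 1 (fderiv ℝ G) u := h.contDiffAt.fderiv_right (by norm_num)
  have hK : ContDiffAt ℝ 1 (fun v => koszulForm (fderiv ℝ G v)) u := by
    have hflip : ContDiffAt ℝ 1 (fun v => (fderiv ℝ G v).flip) u :=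
      (ContinuousLinearMap.flipₗᵢ ℝ E E (E →L[ℝ] ℝ)).contDiff.contDiffAt.comp u hD
    unfold koszulForm
    exact ((hD.add hflip).sub (contDiffAt_const.clm_comp hflip)).const_smul (1 / 2 : ℝ)
  exact ((ContinuousLinearMap.compL ℝ E (E →L[ℝ] ℝ) E).contDiff.contDiffAt.comp u
    hinv).clm_comp hK

theorem differentiableAt_christoffel (h : IsMetricNear G u) :
    DifferentiableAt ℝ (christoffel G) u :=
  h.contDiffAt_christoffel.differentiableAt (by simp)

theorem fderiv_christoffel_symm (h : IsMetricNear G u) (X Y Z : E) :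
    fderiv ℝ (christoffel G) u X Y Z = fderiv ℝ (christoffel G) u X Z Y := by
  rw [fderiv_apply_apply h.differentiableAt_christoffel,
    fderiv_apply_apply h.differentiableAt_christoffel]
  have : (fun v => christoffel G v Y Z) =ᶠ[𝓝 u] fun v => christoffel G v Z Y :=
    h.eventually.mono fun v hv => hv.christoffel_symm Y Z
  rw [this.fderiv_eq]

/-- The first Bianchi identity. -/
theorem curvatureInChart_bianchi (h : IsMetricNear G u) (X Y Z : E) :
    curvatureInChart G u X Y Z + curvatureInChart G u Y Z X + curvatureInChart G u Z X Y = 0 := by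
  simp only [curvatureInChart, add_apply, sub_apply, ContinuousLinearMap.comp_apply]
  rw [h.fderiv_christoffel_symm X Z Y, h.fderiv_christoffel_symm Y Z X,
    h.fderiv_christoffel_symm Z Y X, h.christoffel_symm Z Y, h.christoffel_symm Z X,
    h.christoffel_symm Y X]
  abel

/-- The second derivatives of the metric, expressed by differentiating the compatibility of the
Levi-Civita connection with the metric. -/
theorem fderiv_fderiv_apply (h : IsMetricNear G u) (X Y Z W : E) :
    fderiv ℝ (fderiv ℝ G) u X Y Z W =
      fderiv ℝ G u X (christoffel G u Y Z) W + G u (fderiv ℝ (christoffel G) u X Y Z) W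
        + (fderiv ℝ G u X Z (christoffel G u Y W)
          + G u Z (fderiv ℝ (christoffel G) u X Y W)) := by
  have hD : DifferentiableAt ℝ (fderiv ℝ G) u :=
    (h.contDiffAt.fderiv_right (m := 1) (by norm_num)).differentiableAt (by simp)
  have hDY : HasFDerivAt (fun v => fderiv ℝ G v Y Z W) _ u :=
    (((hD.hasFDerivAt.clm_apply (hasFDerivAt_const Y u)).clm_apply
      (hasFDerivAt_const Z u)).clm_apply (hasFDerivAt_const W u))
  have hG := h.differentiableAt.hasFDerivAt
  have hΓ := fun V : E => (h.differentiableAt_christoffel.hasFDerivAt.clm_apply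
    (hasFDerivAt_const Y u)).clm_apply (hasFDerivAt_const V u)
  have hR := ((hG.clm_apply (hΓ Z)).clm_apply (hasFDerivAt_const W u)).add
    ((hG.clm_apply (hasFDerivAt_const Z u)).clm_apply (hΓ W))
  have heq : (fun v => fderiv ℝ G v Y Z W) =ᶠ[𝓝 u]
      fun v => G v (christoffel G v Y Z) W + G v Z (christoffel G v Y W) :=
    h.eventually.mono fun v hv => hv.fderiv_eq Y Z W
  have := DFunLike.congr_fun (hDY.unique (hR.congr_of_eventuallyEq heq)) X
  simp at this
  rw [this]
  ring

/-- The curvature endomorphisms are skew-adjoint: antisymmetrizing the second derivatives of the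
metric in the two directions of differentiation gives zero on one side, and on the other the two
terms of the identity. -/
theorem inner_curvatureInChart_skew (h : IsMetricNear G u) (X Y Z W : E) :
    G u (curvatureInChart G u X Y Z) W = - G u Z (curvatureInChart G u X Y W) := by
  have hs : fderiv ℝ (fderiv ℝ G) u X Y = fderiv ℝ (fderiv ℝ G) u Y X :=
    h.contDiffAt.isSymmSndFDerivAt (by simp) X Y
  have hs' : fderiv ℝ (fderiv ℝ G) u X Y Z W = fderiv ℝ (fderiv ℝ G) u Y X Z W := by rw [hs]
  rw [h.fderiv_fderiv_apply, h.fderiv_fderiv_apply] at hs'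
  simp only [h.fderiv_eq] at hs'
  simp only [curvatureInChart, add_apply, sub_apply, ContinuousLinearMap.comp_apply, map_add,
    map_sub]
  linarith

end IsMetricNear

theorem curvatureInChart_antisymm (G : E → E →L[ℝ] E →L[ℝ] ℝ) (u X Y Z : E) :
    curvatureInChart G u X Y Z = - curvatureInChart G u Y X Z := by
  simp only [curvatureInChart, add_apply, sub_apply, ContinuousLinearMap.comp_apply]
  abel

end Chart

/-! ### Algebraic curvature tensors -/

section Algebraic

variable {E : Type*} [AddCommGroup E]

/-- A form on four vectors, additive in each slot, with the symmetries of a curvature tensor vanishes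
as soon as it vanishes on all planes, that is, as soon as its sectional curvatures are zero. -/
theorem eq_zero_of_curvature_symmetries (T : E → E → E → E → ℝ)
    (add₁ : ∀ X X' Y Z W, T (X + X') Y Z W = T X Y Z W + T X' Y Z W)
    (add₃ : ∀ X Y Z Z' W, T X Y (Z + Z') W = T X Y Z W + T X Y Z' W)
    (antisymm : ∀ X Y Z W, T X Y Z W = - T Y X Z W)
    (skew : ∀ X Y Z W, T X Y Z W = - T X Y W Z)
    (bianchi : ∀ X Y Z W, T X Y Z W + T Y Z X W + T Z X Y W = 0)
    (plane : ∀ X Y, T X Y Y X = 0) (X Y Z W : E) : T X Y Z W = 0 := by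
  have add₂ : ∀ X Y Y' Z W, T X (Y + Y') Z W = T X Y Z W + T X Y' Z W := fun X Y Y' Z W => by
    rw [antisymm, add₁, antisymm Y, antisymm Y']; ring
  have add₄ : ∀ X Y Z W W', T X Y Z (W + W') = T X Y Z W + T X Y Z W' := fun X Y Z W W' => by
    rw [skew, add₃, skew _ _ W, skew _ _ W']; ring
  have pair : ∀ X Y Z W, T X Y Z W = T Z W X Y := fun X Y Z W => by
    -- Summing the Bianchi identities over the four choices of the fixed index makes all terms
    -- cancel except the two that are to be compared.
    linarith [bianchi Y Z X W, bianchi Z X W Y, bianchi X W Y Z, bianchi W Y Z X,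
      skew Y Z X W, skew Z X Y W, skew X W Z Y, skew W Y X Z,
      antisymm X Y Z W, skew Y X Z W, skew Z W X Y, antisymm Z W X Y]
  have swap : ∀ X Y V, T X Y V X = 0 := fun X Y V => by
    have h := plane X (Y + V)
    rw [add₂, add₃, add₃, plane, plane] at h
    linarith [pair X V Y X, antisymm Y X X V, skew X Y X V]
  have alt : ∀ X Y Z W, T X Y Z W = - T W Y Z X := fun X Y Z W => by
    have h := swap (X + W) Y Z
    rw [add₁, add₄, add₄, swap, swap] at h
    linarith
  -- The form is now alternating in all four slots, so the three terms of the Bianchi identity agree.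
  linarith [bianchi X Y Z W, alt Y Z X W, alt Z X Y W, pair W Z X Y, pair W X Y Z,
    skew X Y Z W, skew Y Z X W]

end Algebraic

/-! ### Metrics of constant sectional curvature -/

section SpaceForm

variable {E : Type*} [NormedAddCommGroup E] [NormedSpace ℝ E]
  {G : E → E →L[ℝ] E →L[ℝ] ℝ} {u : E}

/-- The Gram determinant of two independent vectors is positive (strict Cauchy–Schwarz). -/
theorem IsMetricNear.gram_pos (h : IsMetricNear G u) {X Y : E}
    (hXY : LinearIndependent ℝ ![X, Y]) : 0 < G u X X * G u Y Y - G u X Y ^ 2 := by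
  rw [LinearIndependent.pair_iff] at hXY
  have hY : 0 < G u Y Y := h.pos.self_of_nhds Y fun h0 => by
    simpa using hXY 0 1 (by simp [h0])
  have hV : G u Y Y • X + (-G u X Y) • Y ≠ 0 := fun h0 => hY.ne' (hXY _ _ h0).1
  have hpos := h.pos.self_of_nhds _ hV
  simp only [map_add, map_smul, add_apply, smul_apply, smul_eq_mul,
    h.symm.self_of_nhds Y X] at hpos
  refine pos_of_mul_pos_right (a := G u Y Y) ?_ hY.le
  linarith

variable [FiniteDimensional ℝ E]

/-- Constant sectional curvature determines the curvature endomorphisms. -/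
theorem IsMetricNear.curvatureInChart_eq (h : IsMetricNear G u) {c : ℝ}
    (hc : ∀ X Y : E, LinearIndependent ℝ ![X, Y] →
      G u (curvatureInChart G u X Y Y) X / (G u X X * G u Y Y - G u X Y ^ 2) = c) (X Y Z : E) :
    curvatureInChart G u X Y Z = c • (G u Y Z • X - G u X Z • Y) := by
  have hs := h.symm.self_of_nhds
  refine h.eq_of_forall_apply_eq fun W => ?_
  -- The difference of the two sides is an algebraic curvature tensor with no sectional curvature.
  have key := eq_zero_of_curvature_symmetries (fun X Y Z W =>
    G u (curvatureInChart G u X Y Z) W - c * (G u Y Z * G u X W - G u X Z * G u Y W))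
    (fun X X' Y Z W => by simp [curvatureInChart_add]; ring)
    (fun X Y Z Z' W => by simp; ring)
    (fun X Y Z W => by
      rw [curvatureInChart_antisymm G u X Y Z]; simp; ring)
    (fun X Y Z W => by
      rw [h.inner_curvatureInChart_skew X Y Z W, hs Z]; ring)
    (fun X Y Z W => by
      have hb := congrArg (fun V => G u V W) (h.curvatureInChart_bianchi X Y Z)
      simp only [map_add, add_apply, map_zero, zero_apply] at hb
      rw [hs Z X, hs Z Y, hs Y X]
      linear_combination hb)
    (fun X Y => by
      by_cases hXY : LinearIndependent ℝ ![X, Y]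
      · have h1 := hc X Y hXY
        rw [div_eq_iff (h.gram_pos hXY).ne'] at h1
        rw [h1, hs Y X]; ring
      · -- Both tensors are alternating in the first two slots, so they vanish on dependent vectors.
        have hself : ∀ V V', curvatureInChart G u V V V' = 0 := fun V V' => by
          have := curvatureInChart_antisymm G u V V V'
          have h2 : (2 : ℝ) • curvatureInChart G u V V V' = 0 := by
            rw [two_smul]
            nth_rewrite 1 [this]
            exact neg_add_cancel _
          exact (smul_eq_zero.1 h2).resolve_left two_ne_zero
        by_cases hX : X = 0
        · simp [hX]
        · have hY : ∃ a : ℝ, a • X = Y := by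
            by_contra hne
            exact hXY ((LinearIndependent.pair_iff' hX).2 (not_exists.1 hne))
          obtain ⟨a, rfl⟩ := hY
          rw [curvatureInChart_antisymm, curvatureInChart_smul, hself]
          simp only [smul_zero, neg_zero, map_smul, map_zero, zero_apply, smul_apply, smul_eq_mul]
          ring)
    X Y Z W
  simp only [map_smul, map_sub, smul_apply, sub_apply, smul_eq_mul]
  linarith

end SpaceForm

/-! ### Products of metrics on vector spaces -/

section Product

variable {E₁ : Type*} [NormedAddCommGroup E₁] [NormedSpace ℝ E₁] [FiniteDimensional ℝ E₁]
  {E₂ : Type*} [NormedAddCommGroup E₂] [NormedSpace ℝ E₂] [FiniteDimensional ℝ E₂]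
  {G₁ : E₁ → E₁ →L[ℝ] E₁ →L[ℝ] ℝ} {G₂ : E₂ → E₂ →L[ℝ] E₂ →L[ℝ] ℝ}
  {G : E₁ × E₂ → (E₁ × E₂) →L[ℝ] (E₁ × E₂) →L[ℝ] ℝ} {u : E₁ × E₂}

omit [FiniteDimensional ℝ E₁] [FiniteDimensional ℝ E₂] in
theorem fderiv_of_product (h : DifferentiableAt ℝ G u) (h₁ : DifferentiableAt ℝ G₁ u.1)
    (h₂ : DifferentiableAt ℝ G₂ u.2)
    (hG : ∀ᶠ v in 𝓝 u, ∀ X Y, G v X Y = G₁ v.1 X.1 Y.1 + G₂ v.2 X.2 Y.2) (X Y Z : E₁ × E₂) :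
    fderiv ℝ G u X Y Z = fderiv ℝ G₁ u.1 X.1 Y.1 Z.1 + fderiv ℝ G₂ u.2 X.2 Y.2 Z.2 := by
  have heq : (fun v => G v Y Z) =ᶠ[𝓝 u]
      fun v => G₁ v.1 Y.1 Z.1 + G₂ v.2 Y.2 Z.2 := hG.mono fun v hv => hv Y Z
  have d₁ : DifferentiableAt ℝ (fun v => G₁ v Y.1 Z.1) u.1 := by fun_prop
  have d₂ : DifferentiableAt ℝ (fun v => G₂ v Y.2 Z.2) u.2 := by fun_prop
  have hD := (d₁.hasFDerivAt.comp u hasFDerivAt_fst).add (d₂.hasFDerivAt.comp u hasFDerivAt_snd)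
  rw [fderiv_apply_apply h, fderiv_apply_apply h₁, fderiv_apply_apply h₂,
    (hD.congr_of_eventuallyEq heq).fderiv]
  simp

theorem christoffel_of_product (h : IsMetricNear G u) (h₁ : IsMetricNear G₁ u.1)
    (h₂ : IsMetricNear G₂ u.2)
    (hG : ∀ᶠ v in 𝓝 u, ∀ X Y, G v X Y = G₁ v.1 X.1 Y.1 + G₂ v.2 X.2 Y.2) (X Y : E₁ × E₂) :
    christoffel G u X Y = (christoffel G₁ u.1 X.1 Y.1, christoffel G₂ u.2 X.2 Y.2) := by
  refine h.eq_of_forall_apply_eq fun Z => ?_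
  rw [h.inner_christoffel, hG.self_of_nhds, h₁.inner_christoffel, h₂.inner_christoffel]
  simp only [fderiv_of_product h.differentiableAt h₁.differentiableAt h₂.differentiableAt hG]
  ring

/-- The curvature of a product metric splits. -/
theorem curvatureInChart_of_product (h : IsMetricNear G u) (h₁ : IsMetricNear G₁ u.1)
    (h₂ : IsMetricNear G₂ u.2)
    (hG : ∀ᶠ v in 𝓝 u, ∀ X Y, G v X Y = G₁ v.1 X.1 Y.1 + G₂ v.2 X.2 Y.2) (X Y Z : E₁ × E₂) :
    curvatureInChart G u X Y Z =
      (curvatureInChart G₁ u.1 X.1 Y.1 Z.1, curvatureInChart G₂ u.2 X.2 Y.2 Z.2) := by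
  have hΓ : ∀ᶠ v in 𝓝 u, ∀ X Y, christoffel G v X Y =
      (christoffel G₁ v.1 X.1 Y.1, christoffel G₂ v.2 X.2 Y.2) := by
    filter_upwards [h.eventually, continuousAt_fst.eventually h₁.eventually,
      continuousAt_snd.eventually h₂.eventually, hG.eventually_nhds] with v k k₁ k₂ kG
    exact christoffel_of_product k k₁ k₂ kG
  have hD : ∀ X Y Z, fderiv ℝ (christoffel G) u X Y Z =
      (fderiv ℝ (christoffel G₁) u.1 X.1 Y.1 Z.1, fderiv ℝ (christoffel G₂) u.2 X.2 Y.2 Z.2) := by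
    intro X Y Z
    have e₁ := h₁.differentiableAt_christoffel
    have e₂ := h₂.differentiableAt_christoffel
    have heq : (fun v => christoffel G v Y Z) =ᶠ[𝓝 u]
        fun v => (christoffel G₁ v.1 Y.1 Z.1, christoffel G₂ v.2 Y.2 Z.2) :=
      hΓ.mono fun v hv => hv Y Z
    have d₁ : DifferentiableAt ℝ (fun v => christoffel G₁ v Y.1 Z.1) u.1 := by fun_prop
    have d₂ : DifferentiableAt ℝ (fun v => christoffel G₂ v Y.2 Z.2) u.2 := by fun_prop
    have hD := (d₁.hasFDerivAt.comp u hasFDerivAt_fst).prodMk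
      (d₂.hasFDerivAt.comp u hasFDerivAt_snd)
    rw [fderiv_apply_apply h.differentiableAt_christoffel, fderiv_apply_apply e₁,
      fderiv_apply_apply e₂, (hD.congr_of_eventuallyEq heq).fderiv]
    simp
  simp only [curvatureInChart, add_apply, sub_apply, ContinuousLinearMap.comp_apply, hD,
    hΓ.self_of_nhds, Prod.mk_add_mk, Prod.mk_sub_mk]

end Product

/-! ### Riemannian metrics read in the preferred charts -/

section Manifold

variable {E : Type*} [NormedAddCommGroup E] [NormedSpace ℝ E]
  {H : Type*} [TopologicalSpace H] {I : ModelWithCorners ℝ E H}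
  {M : Type*} [TopologicalSpace M] [ChartedSpace H M] [IsManifold I ∞ M]

theorem metricInChart_apply (g : SmoothMetric I M) (x : M) (u X Y : E) :
    metricInChart g x u X Y =
      g.inner ((extChartAt I x).symm u) (chartSymmDeriv I x u X) (chartSymmDeriv I x u Y) := rfl

variable [I.Boundaryless]

/-- The coordinate vector field of a fixed vector `X` of the chart is smooth. -/
theorem contMDiffAt_chartSymmDeriv_apply (x : M) (X : E) {u : E}
    (hu : u ∈ (extChartAt I x).target) :
    ContMDiffAt 𝓘(ℝ, E) (I.prod 𝓘(ℝ, E)) ∞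
      (fun v => TotalSpace.mk' E (E := fun y : M => TangentSpace I y)
        ((extChartAt I x).symm v) (chartSymmDeriv I x v X)) u := by
  have : IsManifold I 1 M := IsManifold.of_le (n := ∞) (by simp)
  have hopen : IsOpen (extChartAt I x).target := isOpen_extChartAt_target x
  have h := (contMDiffOn_extChartAt_symm (I := I) (n := ∞) x).contMDiffOn_tangentMapWithin
    (m := ∞) (by simp) hopen.uniqueMDiffOn
  have hX : ContMDiff 𝓘(ℝ, E) 𝓘(ℝ, E).tangent ∞
      (fun v : E => (⟨v, X⟩ : TangentBundle 𝓘(ℝ, E) E)) := by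
    intro v
    exact contMDiffAt_vectorSpace_iff_contDiffAt.2 contDiffAt_const
  have h' := (h.comp hX.contMDiffOn (s := (extChartAt I x).target) fun v hv => hv).contMDiffAt
    (hopen.mem_nhds hu)
  refine h'.congr_of_eventuallyEq ?_
  filter_upwards [hopen.mem_nhds hu] with v hv
  simp only [Function.comp_apply, tangentMapWithin, mfderivWithin_of_isOpen hopen hv]
  rfl

theorem chartSymmDeriv_injective (x : M) {u : E} (hu : u ∈ (extChartAt I x).target) :
    Function.Injective (chartSymmDeriv I x u) := by
  have : IsManifold I 1 M := IsManifold.of_le (n := ∞) (by simp)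
  have h := isInvertible_mfderivWithin_extChartAt_symm (I := I) hu
  rw [I.range_eq_univ, mfderivWithin_univ] at h
  exact h.injective

theorem chartSymmDeriv_self (x : M) :
    chartSymmDeriv I x (extChartAt I x x) = ContinuousLinearMap.id ℝ E := by
  have : IsManifold I 1 M := IsManifold.of_le (n := ∞) (by simp)
  have h := mfderivWithin_range_extChartAt_symm (I := I) (x := x)
  rwa [I.range_eq_univ, mfderivWithin_univ] at h

/-- At the centre of the preferred chart the coordinate expression of the metric is the metric
itself, since the fibre there is identified with the model space by that chart. -/
theorem metricInChart_self (g : SmoothMetric I M) (x : M) (X Y : E) :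
    metricInChart g x (extChartAt I x x) X Y = g.inner x X Y := by
  rw [metricInChart_apply, chartSymmDeriv_self, extChartAt_to_inv]
  rfl

theorem contDiffOn_metricInChart [FiniteDimensional ℝ E] (g : SmoothMetric I M) (x : M) :
    ContDiffOn ℝ ∞ (metricInChart g x) (extChartAt I x).target := by
  have : IsManifold I 1 M := IsManifold.of_le (n := ∞) (by simp)
  rw [contDiffOn_clm_apply]
  intro X
  rw [contDiffOn_clm_apply]
  intro Y u hu
  have hs : ContMDiffAt 𝓘(ℝ, E) I ∞ (extChartAt I x).symm u :=
    (contMDiffOn_extChartAt_symm x).contMDiffAt ((isOpen_extChartAt_target x).mem_nhds hu)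
  have := ContMDiffAt.clm_bundle_apply₂ (F₁ := E) (F₂ := E) (F₃ := ℝ)
    (E₁ := fun y : M => TangentSpace I y) (E₂ := fun y : M => TangentSpace I y)
    (E₃ := Bundle.Trivial M ℝ)
    (g.contMDiff.contMDiffAt.comp u hs)
    (contMDiffAt_chartSymmDeriv_apply (I := I) x X hu)
    (contMDiffAt_chartSymmDeriv_apply (I := I) x Y hu)
  rw [contMDiffAt_totalSpace] at this
  exact this.2.contDiffAt.contDiffWithinAt

theorem isMetricNear_metricInChart [FiniteDimensional ℝ E] (g : SmoothMetric I M) (x : M) :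
    IsMetricNear (metricInChart g x) (extChartAt I x x) := by
  have hx : (extChartAt I x).target ∈ 𝓝 (extChartAt I x x) :=
    (isOpen_extChartAt_target x).mem_nhds (mem_extChartAt_target x)
  have h2 : (2 : ℕ∞ω) ≤ ∞ := ENat.LEInfty.out
  refine ⟨((contDiffOn_metricInChart g x).contDiffAt hx).of_le h2,
    Eventually.of_forall fun v X Y => ?_, ?_⟩
  · rw [metricInChart_apply, metricInChart_apply]
    exact g.symm _ _ _
  · filter_upwards [hx] with v hv X hX
    rw [metricInChart_apply]
    refine g.pos _ _ fun h0 => hX (chartSymmDeriv_injective x hv ?_)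
    rw [map_zero]
    exact h0

end Manifold

/-! ### Product metrics read in the preferred charts -/

section Product

variable {E₁ : Type*} [NormedAddCommGroup E₁] [NormedSpace ℝ E₁]
  {H₁ : Type*} [TopologicalSpace H₁] {I₁ : ModelWithCorners ℝ E₁ H₁} [I₁.Boundaryless]
  {M₁ : Type*} [TopologicalSpace M₁] [ChartedSpace H₁ M₁] [IsManifold I₁ ∞ M₁]
  {E₂ : Type*} [NormedAddCommGroup E₂] [NormedSpace ℝ E₂]
  {H₂ : Type*} [TopologicalSpace H₂] {I₂ : ModelWithCorners ℝ E₂ H₂} [I₂.Boundaryless]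
  {M₂ : Type*} [TopologicalSpace M₂] [ChartedSpace H₂ M₂] [IsManifold I₂ ∞ M₂]

theorem chartSymmDeriv_prod (z : M₁ × M₂) {u : E₁ × E₂}
    (h₁ : u.1 ∈ (extChartAt I₁ z.1).target) (h₂ : u.2 ∈ (extChartAt I₂ z.2).target) 
    (X : E₁ × E₂) :
    chartSymmDeriv (I₁.prod I₂) z u X =
      (chartSymmDeriv I₁ z.1 u.1 X.1, chartSymmDeriv I₂ z.2 u.2 X.2) := by
  have : IsManifold I₁ 1 M₁ := IsManifold.of_le (n := ∞) (by simp)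
  have : IsManifold I₂ 1 M₂ := IsManifold.of_le (n := ∞) (by simp)
  have d₁ : MDifferentiableAt 𝓘(ℝ, E₁) I₁ (extChartAt I₁ z.1).symm u.1 := by
    have := mdifferentiableWithinAt_extChartAt_symm (I := I₁) h₁
    rwa [I₁.range_eq_univ, mdifferentiableWithinAt_univ] at this
  have d₂ : MDifferentiableAt 𝓘(ℝ, E₂) I₂ (extChartAt I₂ z.2).symm u.2 := by
    have := mdifferentiableWithinAt_extChartAt_symm (I := I₂) h₂
    rwa [I₂.range_eq_univ, mdifferentiableWithinAt_univ] at this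
  have hd₁ : MDifferentiableAt 𝓘(ℝ, E₁ × E₂) 𝓘(ℝ, E₁) Prod.fst u :=
    differentiableAt_fst.mdifferentiableAt
  have hd₂ : MDifferentiableAt 𝓘(ℝ, E₁ × E₂) 𝓘(ℝ, E₂) Prod.snd u :=
    differentiableAt_snd.mdifferentiableAt
  have hs : ((extChartAt (I₁.prod I₂) z).symm : E₁ × E₂ → M₁ × M₂) =
      fun v => (((extChartAt I₁ z.1).symm ∘ Prod.fst) v, ((extChartAt I₂ z.2).symm ∘ Prod.snd) v) := by
    rw [extChartAt_prod]; rfl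
  unfold chartSymmDeriv
  rw [hs, mfderiv_prodMk (d₁.comp u hd₁) (d₂.comp u hd₂), mfderiv_comp u d₁ hd₁,
    mfderiv_comp u d₂ hd₂, mfderiv_eq_fderiv, mfderiv_eq_fderiv, fderiv_fst, fderiv_snd]
  rfl

theorem IsProductMetric.metricInChart_eq {g₁ : SmoothMetric I₁ M₁} {g₂ : SmoothMetric I₂ M₂}
    {g : SmoothMetric (I₁.prod I₂) (M₁ × M₂)} (h : IsProductMetric g₁ g₂ g) (z : M₁ × M₂)
    {u : E₁ × E₂} (h₁ : u.1 ∈ (extChartAt I₁ z.1).target)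
    (h₂ : u.2 ∈ (extChartAt I₂ z.2).target) (X Y : E₁ × E₂) :
    metricInChart g z u X Y =
      metricInChart g₁ z.1 u.1 X.1 Y.1 + metricInChart g₂ z.2 u.2 X.2 Y.2 := by
  have hs : (extChartAt (I₁.prod I₂) z).symm u =
      ((extChartAt I₁ z.1).symm u.1, (extChartAt I₂ z.2).symm u.2) := by
    rw [extChartAt_prod]; rfl
  rw [metricInChart_apply, chartSymmDeriv_prod z h₁ h₂, chartSymmDeriv_prod z h₁ h₂, hs]
  refine (h _ _ _).trans ?_
  rw [mfderiv_fst, mfderiv_snd]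
  rfl

variable [FiniteDimensional ℝ E₁] [FiniteDimensional ℝ E₂]

theorem IsProductMetric.curvature_eq {g₁ : SmoothMetric I₁ M₁} {g₂ : SmoothMetric I₂ M₂}
    {g : SmoothMetric (I₁.prod I₂) (M₁ × M₂)} (h : IsProductMetric g₁ g₂ g) (z : M₁ × M₂)
    (X Y Z : E₁ × E₂) :
    curvature g z X Y Z =
      ((curvature g₁ z.1 X.1 Y.1 Z.1, curvature g₂ z.2 X.2 Y.2 Z.2) : E₁ × E₂) := by
  have hz : extChartAt (I₁.prod I₂) z z = (extChartAt I₁ z.1 z.1, extChartAt I₂ z.2 z.2) := by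
    rw [extChartAt_prod]; rfl
  have hm := isMetricNear_metricInChart g z
  unfold curvature
  rw [hz] at hm ⊢
  refine curvatureInChart_of_product hm (isMetricNear_metricInChart g₁ z.1)
    (isMetricNear_metricInChart g₂ z.2) ?_ X Y Z
  filter_upwards [continuousAt_fst.preimage_mem_nhds
      ((isOpen_extChartAt_target (I := I₁) z.1).mem_nhds (mem_extChartAt_target z.1)),
    continuousAt_snd.preimage_mem_nhds
      ((isOpen_extChartAt_target (I := I₂) z.2).mem_nhds (mem_extChartAt_target z.2))]
    with v h₁ h₂
  exact h.metricInChart_eq z h₁ h₂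

end Product

/-! ### Space forms -/

section SpaceForm

variable {E : Type*} [NormedAddCommGroup E] [NormedSpace ℝ E] [FiniteDimensional ℝ E]
  {H : Type*} [TopologicalSpace H] {I : ModelWithCorners ℝ E H} [I.Boundaryless]
  {M : Type*} [TopologicalSpace M] [ChartedSpace H M] [IsManifold I ∞ M]

theorem curvature_skew (g : SmoothMetric I M) (x : M) (X Y Z W : TangentSpace I x) :
    g.inner x (curvature g x X Y Z) W = - g.inner x Z (curvature g x X Y W) := by
  have h := (isMetricNear_metricInChart g x).inner_curvatureInChart_skew X Y Z W
  exact (metricInChart_self g x _ _).symm.trans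
    (h.trans (congrArg Neg.neg (metricInChart_self g x _ _)))

theorem HasConstantSectionalCurvature.curvature_eq {g : SmoothMetric I M} {c : ℝ}
    (h : HasConstantSectionalCurvature g c) (x : M) (X Y Z : TangentSpace I x) :
    curvature g x X Y Z = c • (g.inner x Y Z • X - g.inner x X Z • Y) := by
  let B : E →L[ℝ] E →L[ℝ] ℝ := g.inner x
  have hB : metricInChart g x (extChartAt I x x) = B := by
    ext V W
    exact metricInChart_self g x V W
  have hm := isMetricNear_metricInChart g x
  have hR := hm.curvatureInChart_eq (c := c)
    (fun V W hVW => by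
      rw [hB]
      exact h x V W hVW) X Y Z
  rw [hB] at hR
  exact hR

/-- A space form of dimension `n` and curvature `c` is an Einstein manifold: `S = c (n - 1) g`. -/
theorem HasConstantSectionalCurvature.ricci_eq {g : SmoothMetric I M} {c : ℝ}
    (h : HasConstantSectionalCurvature g c) (x : M) (X Y : TangentSpace I x) :
    ricci g x X Y = c * (Module.finrank ℝ E - 1) * g.inner x X Y := by
  let B : E →L[ℝ] E →L[ℝ] ℝ := g.inner x
  let X' : E := X
  let Y' : E := Y
  have hmap : (curvatureFirstSlot g x X Y : E →ₗ[ℝ] E) =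
      c • (B X' Y' • LinearMap.id - (B.flip Y' : E →ₗ[ℝ] ℝ).smulRight X') :=
    LinearMap.ext fun V => h.curvature_eq x V X Y
  have htrace : LinearMap.trace ℝ E
      (c • (B X' Y' • LinearMap.id - (B.flip Y' : E →ₗ[ℝ] ℝ).smulRight X')) =
      c * (Module.finrank ℝ E - 1) * B X' Y' := by
    rw [map_smul, map_sub, map_smul, LinearMap.trace_id, LinearMap.trace_smulRight]
    simp only [smul_eq_mul, ContinuousLinearMap.coe_coe, ContinuousLinearMap.flip_apply]
    ring
  exact (congrArg (LinearMap.trace ℝ E) hmap).trans htrace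

/-- The Ricci tensor is a multiple of the metric, for which `R(X, Y)` is skew-adjoint. -/
theorem HasConstantSectionalCurvature.curvatureDotRicci_eq_zero {g : SmoothMetric I M} {c : ℝ}
    (h : HasConstantSectionalCurvature g c) (x : M) (X Y Z W : TangentSpace I x) :
    curvatureDotRicci g x X Y Z W = 0 := by
  rw [curvatureDotRicci, h.ricci_eq, h.ricci_eq, curvature_skew]
  ring

end SpaceForm

/-! ### Products of space forms -/

section Product

variable {E₁ : Type*} [NormedAddCommGroup E₁] [NormedSpace ℝ E₁] [FiniteDimensional ℝ E₁]
  {H₁ : Type*} [TopologicalSpace H₁] {I₁ : ModelWithCorners ℝ E₁ H₁} [I₁.Boundaryless]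
  {M₁ : Type*} [TopologicalSpace M₁] [ChartedSpace H₁ M₁] [IsManifold I₁ ∞ M₁]
  {E₂ : Type*} [NormedAddCommGroup E₂] [NormedSpace ℝ E₂] [FiniteDimensional ℝ E₂]
  {H₂ : Type*} [TopologicalSpace H₂] {I₂ : ModelWithCorners ℝ E₂ H₂} [I₂.Boundaryless]
  {M₂ : Type*} [TopologicalSpace M₂] [ChartedSpace H₂ M₂] [IsManifold I₂ ∞ M₂]
  {g₁ : SmoothMetric I₁ M₁} {g₂ : SmoothMetric I₂ M₂} {g : SmoothMetric (I₁.prod I₂) (M₁ × M₂)}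

theorem IsProductMetric.ricci_eq (h : IsProductMetric g₁ g₂ g) (z : M₁ × M₂) (X Y : E₁ × E₂) :
    ricci g z X Y = ricci g₁ z.1 X.1 Y.1 + ricci g₂ z.2 X.2 Y.2 := by
  let A₁ : E₁ →ₗ[ℝ] E₁ := curvatureFirstSlot g₁ z.1 X.1 Y.1
  let A₂ : E₂ →ₗ[ℝ] E₂ := curvatureFirstSlot g₂ z.2 X.2 Y.2
  have hmap : (curvatureFirstSlot g z X Y : E₁ × E₂ →ₗ[ℝ] E₁ × E₂) = A₁.prodMap A₂ :=
    LinearMap.ext fun V => h.curvature_eq z V X Y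
  exact (congrArg (LinearMap.trace ℝ (E₁ × E₂)) hmap).trans (LinearMap.trace_prodMap' _ _)

theorem IsProductMetric.curvatureDotRicci_eq (h : IsProductMetric g₁ g₂ g) (z : M₁ × M₂)
    (X Y Z W : E₁ × E₂) :
    curvatureDotRicci g z X Y Z W =
      curvatureDotRicci g₁ z.1 X.1 Y.1 Z.1 W.1 + curvatureDotRicci g₂ z.2 X.2 Y.2 Z.2 W.2 := by
  have hS : ∀ V : E₁ × E₂, curvature g z X Y V =
      ((curvature g₁ z.1 X.1 Y.1 V.1, curvature g₂ z.2 X.2 Y.2 V.2) : E₁ × E₂) :=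
    h.curvature_eq z X Y
  have e₁ := (congrArg (fun V => ricci g z V W) (hS Z)).trans (h.ricci_eq z _ W)
  have e₂ := (congrArg (fun V => ricci g z Z V) (hS W)).trans (h.ricci_eq z Z _)
  refine (congrArg₂ (fun a b => -a - b) e₁ e₂).trans ?_
  unfold curvatureDotRicci
  ring

end Product

end GoldenGeometry

theorem mainTheorem12
    {E₁ : Type*} [NormedAddCommGroup E₁] [NormedSpace ℝ E₁] [FiniteDimensional ℝ E₁]
    {H₁ : Type*} [TopologicalSpace H₁] (I₁ : ModelWithCorners ℝ E₁ H₁) [I₁.Boundaryless]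
    (M₁ : Type*) [TopologicalSpace M₁] [ChartedSpace H₁ M₁] [IsManifold I₁ ∞ M₁]
    {E₂ : Type*} [NormedAddCommGroup E₂] [NormedSpace ℝ E₂] [FiniteDimensional ℝ E₂]
    {H₂ : Type*} [TopologicalSpace H₂] (I₂ : ModelWithCorners ℝ E₂ H₂) [I₂.Boundaryless]
    (M₂ : Type*) [TopologicalSpace M₂] [ChartedSpace H₂ M₂] [IsManifold I₂ ∞ M₂]
    (g₁ : GoldenGeometry.SmoothMetric I₁ M₁) (c₁ : ℝ)
    (g₂ : GoldenGeometry.SmoothMetric I₂ M₂) (c₂ : ℝ)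
    (g : GoldenGeometry.SmoothMetric (I₁.prod I₂) (M₁ × M₂))
    (φ : GoldenGeometry.EndField (I₁.prod I₂) (M₁ × M₂))
    (hM : GoldenGeometry.IsGoldenProductSpaceForm g₁ c₁ g₂ c₂ g φ)
    (hφ : GoldenGeometry.IsIntegrable g φ)
    (z : M₁ × M₂) (X Y Z W : TangentSpace (I₁.prod I₂) z) :
    GoldenGeometry.curvatureDotRicci g z (φ z X) Y (φ z Z) W = 0 := by
  refine (hM.product.curvatureDotRicci_eq z _ _ _ _).trans ?_
  exact (congrArg₂ (· + ·) (hM.spaceForm₁.curvatureDotRicci_eq_zero _ _ _ _ _)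
    (hM.spaceForm₂.curvatureDotRicci_eq_zero _ _ _ _ _)).trans (add_zero 0)
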